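/- Let $E$ be a countable set and let $r(x,y)\ge 0$, $x\neq y\in E$, be jump rates with finite holding rates $\lambda(x)=\sum_{y}r(x,y)<\infty$. Let $X_t$ be the continuous-time Markov chain on $E$ with these rates, i.e. with generator $(Lf)(x)=\sum_{y}r(x,y)[f(y)-f(x)]$: from $x$ it jumps after an exponential time of rate $\lambda(x)$ to a state chosen with law $p(x,y)=r(x,y)/\lambda(x)$ (the minimal chain, which is killed if it explodes; a state with $\lambda(x)=0$ is absorbing). Assume that $X_t$ is irreducible, that is, any state can be reached from any other through jumps of positive rate, and that it admits a stationary measure: a nonzero $\mu:E\to[0,\infty)$, possibly of infinite total mass, with $\sum_{x}\mu(x)r(x,y)=\mu(y)\lambda(y)$ for every $y\in E$. Let $L^*$ be the adjoint of $L$ in $L^2(\mu)$, which is the generator of the chain with rates $r^*(x,y)=\mu(y)r(y,x)/\mu(x)$, and let $X^s_t$ be the reversible version of $X_t$, i.e. the Markov chain with generator $S=\tfrac12(L+L^*)$ and jump rates $\tfrac12[r(x,y)+r^*(x,y)]$. Write $\langle f,g\rangle_\mu=\sum_{x}\mu(x)f(x)g(x)$. Suppose that 1. $L$ satisfies a sector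 condition: there is a constant $C_0$ such that for all finitely supported $f,g:E\to\mathbb R$, $$\langle Lf,g\rangle_\mu^2\;\le\; C_0\,\langle(-L)f,f\rangle_\mu\,\langle(-L)g,g\rangle_\mu ;$$ 2. $X^s_t$ is recurrent. Then $X_t$ is recurrent. Here a chain $Z_t$ on $E$ is called recurrent if for every state $x$ either $x$ is absorbing, or the chain started from $x$ returns to $x$ in finite time with probability one: $\mathbb P_x[T_x^+<\infty]=1$, where $T_x^+=\inf\{t>0: Z_t=x,\ Z_s\neq Z_0\text{ for some }0<s<t\}$. -/

import Mathlib

open MeasureTheory ProbabilityTheory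
open scoped NNReal ENNReal

noncomputable section

/-- Jump rates `r(x,y)`, `x ≠ y`, of a continuous-time Markov chain on `E` all of whose
holding rates `∑ y, r(x,y)` are finite. The diagonal carries no rate. -/
structure JumpRates (E : Type*) where
  rate : E → E → ℝ≥0
  rate_self : ∀ x, rate x x = 0
  summable_rate : ∀ x, Summable (rate x)

namespace JumpRates

variable {E : Type*}

/-- The holding rate `λ(x) = ∑ y, r(x,y)`. -/
def holdingRate (r : JumpRates E) (x : E) : ℝ≥0 := ∑' y, r.rate x y

/-- Every state can be reached from every state by jumps of positive rate. -/
def Irreducible (r : JumpRates E) : Prop :=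
  ∀ x y, Relation.ReflTransGen (fun a b => 0 < r.rate a b) x y

/-- The jump distribution `p(x,·) = r(x,·) / λ(x)`; a state with `λ(x) = 0` is absorbing. -/
def jumpPMF (r : JumpRates E) (x : E) : PMF E :=
  open Classical in
  if h : r.holdingRate x = 0 then PMF.pure x
  else PMF.normalize (fun y => (r.rate x y : ℝ≥0∞))
    (by rwa [← ENNReal.coe_tsum (r.summable_rate x), ENNReal.coe_ne_zero])
    (by rw [← ENNReal.coe_tsum (r.summable_rate x)]; exact ENNReal.coe_ne_top)

section PathLaw

variable [Countable E] [MeasurableSpace E] [DiscreteMeasurableSpace E]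

/-- The one-step transition kernel of the jump chain. -/
def jumpKernel (r : JumpRates E) : Kernel E E :=
  Kernel.ofFunOfCountable fun x => (r.jumpPMF x).toMeasure

instance (r : JumpRates E) : IsMarkovKernel r.jumpKernel :=
  ⟨fun x => PMF.toMeasure.isProbabilityMeasure (r.jumpPMF x)⟩

/-- The one-step kernel as a function of the whole past `(y₀, …, yₙ)`, depending on `yₙ` only. -/
def historyKernel (r : JumpRates E) (n : ℕ) :
    Kernel ((i : Finset.Iic n) → (fun _ : ℕ => E) i) E :=
  r.jumpKernel.comap (fun y => y ⟨n, Finset.mem_Iic.2 le_rfl⟩) (measurable_pi_apply _)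

instance (r : JumpRates E) (n : ℕ) : IsMarkovKernel (r.historyKernel n) := by
  unfold historyKernel; infer_instance

/-- The law of the discrete-time jump chain `(Yₙ)` started from `x`. -/
def jumpChainLaw (r : JumpRates E) (x : E) : Measure (ℕ → E) :=
  Kernel.trajMeasure (X := fun _ => E) (Measure.dirac x) r.historyKernel

instance isProbabilityMeasure_exp_one : IsProbabilityMeasure (expMeasure 1) :=
  isProbabilityMeasure_expMeasure one_pos

/-- The law of a sequence of independent exponential random variables of mean one. -/
def clockLaw : Measure (ℕ → ℝ) := Measure.infinitePi fun _ : ℕ => expMeasure 1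

/-- The measure `ℙ_x` on which the chain started from `x` is built: a jump chain started from `x`
and, independently of it, a sequence of independent mean-one exponential clocks. -/
def law (r : JumpRates E) (x : E) : Measure ((ℕ → E) × (ℕ → ℝ)) :=
  (r.jumpChainLaw x).prod clockLaw

end PathLaw

/-- The time the chain spends in the `n`-th visited state `Yₙ`: the `n`-th clock divided by
`λ(Yₙ)`, so that given the jump chain it is exponential of rate `λ(Yₙ)` (and `∞` at an absorbing
state). -/
def holdingTime (r : JumpRates E) (ω : (ℕ → E) × (ℕ → ℝ)) (n : ℕ) : ℝ≥0∞ :=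
  ENNReal.ofReal (ω.2 n) / (r.holdingRate (ω.1 n) : ℝ≥0∞)

/-- The time of the `n`-th jump (`0` for `n = 0`). -/
def jumpTime (r : JumpRates E) (ω : (ℕ → E) × (ℕ → ℝ)) (n : ℕ) : ℝ≥0∞ :=
  ∑ k ∈ Finset.range n, r.holdingTime ω k

/-- The continuous-time chain `X_t`: it sits at `Yₙ` between the `n`-th and the `(n+1)`-st jump
times; `none` is a cemetery in which it stays from the explosion time on, if there is one. -/
def X (r : JumpRates E) (ω : (ℕ → E) × (ℕ → ℝ)) (t : ℝ≥0) : Option E :=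
  open Classical in
  if h : ∃ n, (t : ℝ≥0∞) < r.jumpTime ω (n + 1) then some (ω.1 (Nat.find h)) else none

/-- The return time `T_A⁺ = inf {t > 0 : X_t ∈ A, X_s ≠ X_0 for some 0 < s < t}`, infinite if
there is no such `t`. -/
def returnTime (r : JumpRates E) (A : Set E) (ω : (ℕ → E) × (ℕ → ℝ)) : ℝ≥0∞ :=
  sInf {τ | ∃ t : ℝ≥0, τ = t ∧ 0 < t ∧ r.X ω t ∈ some '' A ∧
    ∃ s : ℝ≥0, 0 < s ∧ s < t ∧ r.X ω s ≠ r.X ω 0}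

/-- Recurrence of the chain `X_t`: started from any state `x`, it almost surely returns to `x` in
finite time, or `x` is absorbing and the chain never leaves it. -/
def Recurrent [Countable E] [MeasurableSpace E] [DiscreteMeasurableSpace E]
    (r : JumpRates E) : Prop :=
  ∀ x, r.holdingRate x = 0 ∨ ∀ᵐ ω ∂(r.law x), r.returnTime {x} ω < ∞

/-- A stationary measure: a nonzero measure `μ` on `E` with finite weights such that the flow into
each state balances the flow out of it, `∑ x, μ(x) r(x,y) = μ(y) λ(y)`. Its total mass may be
infinite. -/
structure IsStationary (r : JumpRates E) (μ : E → ℝ≥0) : Prop where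
  ne_zero : μ ≠ 0
  balance : ∀ y, HasSum (fun x => μ x * r.rate x y) (μ y * r.holdingRate y)

/-- The time-reversed chain, of rates `r*(x,y) = μ(y) r(y,x) / μ(x)`. -/
def adjoint (r : JumpRates E) {μ : E → ℝ≥0} (hμ : r.IsStationary μ) : JumpRates E where
  rate x y := μ y * r.rate y x / μ x
  rate_self x := by simp [r.rate_self]
  summable_rate x := (hμ.balance x).summable.div_const (μ x)

/-- The reversible version of the chain, of rates `(r(x,y) + r*(x,y)) / 2`; its generator is
`S = (L + L*) / 2`. -/
def symmetrized (r : JumpRates E) {μ : E → ℝ≥0} (hμ : r.IsStationary μ) : JumpRates E where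
  rate x y := (r.rate x y + (r.adjoint hμ).rate x y) / 2
  rate_self x := by simp [rate_self]
  summable_rate x := ((r.summable_rate x).add ((r.adjoint hμ).summable_rate x)).div_const 2

/-- The generator `(Lf)(x) = ∑ y, r(x,y) (f(y) - f(x))`. -/
def generator (r : JumpRates E) (f : E → ℝ) (x : E) : ℝ :=
  ∑' y, (r.rate x y : ℝ) * (f y - f x)

/-- The scalar product `⟨f, g⟩_μ = ∑ x, μ(x) f(x) g(x)`. -/
def innerMu (μ : E → ℝ≥0) (f g : E → ℝ) : ℝ := ∑' x, (μ x : ℝ) * f x * g x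

/-- The sector condition `⟨Lf, g⟩² ≤ C₀ ⟨-Lf, f⟩ ⟨-Lg, g⟩`, for all functions `f`, `g` of finite
support. -/
def SectorCondition (r : JumpRates E) (μ : E → ℝ≥0) (C₀ : ℝ) : Prop :=
  ∀ f g : E → ℝ, f.support.Finite → g.support.Finite →
    innerMu μ (r.generator f) g ^ 2 ≤
      C₀ * innerMu μ (-r.generator f) f * innerMu μ (-r.generator g) g

end JumpRates

end

/-! Recurrence is compared through escape probabilities from finite sets. For finite `K ∋ o`, let
`h` be the probability of hitting `o` before leaving `K`. It equals 1 at `o`, vanishes off `K` and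
is harmonic on `K \ {o}`, so `⟨-Lh, g⟩ = μ(o) λ(o) e_K` for every `g` that vanishes off `K` with
`g(o) = 1`, where `e_K` is the probability of not returning to `o` before leaving `K`
(`innerMu_generator_potential`).

Let `f` and `g` be these potentials for `L` and for `S`. Since `L` and `S` have the same quadratic
form (`innerMu_symmetrized`) and the same holding rates, the sector condition becomes `e_K² ≤ C₀ e_K
e_K^S` (`SectorCondition.escape_le`). As `K` increases to `E`, recurrence of the reversible chain
gives `e_K^S → 0`, hence `e_K → 0`.

Almost sure return of the jump chain is equivalent to `e_K → 0` (`ae_return_iff_iSup_returnProb`).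
Return in continuous time is the same event up to null sets once no state is absorbing; explosion is
harmless, as only finitely many holding times precede a return. -/

namespace JumpRates

section JumpChain

variable {E : Type*}

/-- The trajectories that avoid `o` at the times `1, …, n`. -/
def avoidSet (o : E) (n : ℕ) : Set (ℕ → E) := {ω | ∀ k, 1 ≤ k → k ≤ n → ω k ≠ o}

lemma mem_avoidSet_succ {o : E} {n : ℕ} {ω : ℕ → E} :
    ω ∈ avoidSet o (n + 1) ↔ ω ∈ avoidSet o n ∧ ω (n + 1) ≠ o := by
  refine ⟨fun h => ⟨fun k hk hk' => h k hk (by omega), h (n + 1) (by omega) le_rfl⟩, ?_⟩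
  rintro ⟨h1, h2⟩ k hk hk'
  rcases Nat.le_succ_iff.1 hk' with h | h
  · exact h1 k hk h
  · exact h ▸ h2

variable [Countable E] [MeasurableSpace E] [DiscreteMeasurableSpace E]

/-! ### The jump chain -/

instance (r : JumpRates E) (x : E) : IsProbabilityMeasure (r.jumpChainLaw x) := by
  unfold jumpChainLaw; infer_instance

instance : IsProbabilityMeasure clockLaw := by
  unfold clockLaw; infer_instance

lemma map_eval_zero_jumpChainLaw (r : JumpRates E) (x : E) :
    (r.jumpChainLaw x).map (fun ω => ω 0) = Measure.dirac x := by
  have h : (fun ω : ℕ → E => ω 0) =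
      (fun y : (i : Finset.Iic 0) → E => y ⟨0, by simp⟩) ∘ Preorder.frestrictLe 0 := rfl
  rw [h, ← Measure.map_map (by fun_prop) (by fun_prop), jumpChainLaw, Kernel.trajMeasure,
    Measure.map_comp _ _ (by fun_prop), Kernel.traj_map_frestrictLe, Kernel.partialTraj_self,
    Measure.id_comp, Measure.map_map (by fun_prop) (by fun_prop)]
  convert! Measure.map_id

lemma ae_eval_zero_jumpChainLaw (r : JumpRates E) (x : E) :
    ∀ᵐ ω ∂(r.jumpChainLaw x), ω 0 = x := by
  have h : ∀ᵐ y ∂(r.jumpChainLaw x).map (fun ω => ω 0), y = x := by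
    rw [map_eval_zero_jumpChainLaw, ae_dirac_eq]
    rfl
  exact ae_of_ae_map (measurable_pi_apply 0).aemeasurable h

/-- The Markov property of the jump chain. -/
lemma lintegral_jumpChainLaw_succ (r : JumpRates E) (x : E) (n : ℕ)
    {F : ((i : Finset.Iic n) → E) → ℝ≥0∞} (hF : Measurable F) (g : E → ℝ≥0∞) :
    ∫⁻ ω, F (Preorder.frestrictLe n ω) * g (ω (n + 1)) ∂(r.jumpChainLaw x) =
      ∫⁻ ω, F (Preorder.frestrictLe n ω) * ∫⁻ y, g y ∂(r.jumpKernel (ω n))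
        ∂(r.jumpChainLaw x) := by
  have hg : Measurable g := Measurable.of_discrete
  have key := Kernel.map_frestrictLe_trajMeasure_compProd_eq_map_trajMeasure
    (X := fun _ => E) (κ := r.historyKernel) (μ₀ := Measure.dirac x) (a := n)
  have hH : Measurable (fun p : ((i : Finset.Iic n) → E) × E => F p.1 * g p.2) := by fun_prop
  have h2 : ∫⁻ p, F p.1 * g p.2 ∂((r.jumpChainLaw x).map
      (fun ω => (Preorder.frestrictLe (π := fun _ : ℕ => E) n ω, ω (n + 1)))) =
      ∫⁻ ω, F (Preorder.frestrictLe n ω) * g (ω (n + 1)) ∂(r.jumpChainLaw x) :=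
    lintegral_map hH (by fun_prop)
  rw [← h2]
  unfold jumpChainLaw
  rw [← key, Measure.lintegral_compProd hH, lintegral_map _ (by fun_prop)]
  · refine lintegral_congr fun ω => ?_
    have h : r.historyKernel n (Preorder.frestrictLe n ω) = r.jumpKernel (ω n) :=
      Kernel.comap_apply ..
    rw [h]
    exact lintegral_const_mul (F (Preorder.frestrictLe n ω)) hg
  · exact Measurable.lintegral_kernel_prod_right' hH

open Classical in
/-- One step of the jump chain killed on entering `o`. -/
noncomputable def tabooStep (r : JumpRates E) (o : E) (g : E → ℝ≥0∞) (x : E) : ℝ≥0∞ :=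
  ∫⁻ y, (if y = o then 0 else g y) ∂(r.jumpKernel x)

lemma measurableSet_avoidSet (o : E) (n : ℕ) : MeasurableSet (avoidSet o n) := by
  have h : avoidSet o n = ⋂ k, ⋂ (_ : 1 ≤ k), ⋂ (_ : k ≤ n), (fun ω : ℕ → E => ω k) ⁻¹' {o}ᶜ := by
    ext ω
    simp [avoidSet]
  rw [h]
  refine MeasurableSet.iInter fun k => MeasurableSet.iInter fun _ => MeasurableSet.iInter fun _ => ?_
  exact (measurableSet_singleton o).compl.preimage (measurable_pi_apply k)

lemma lintegral_avoidSet (r : JumpRates E) (o x : E) (n : ℕ) (g : E → ℝ≥0∞) :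
    ∫⁻ ω, (avoidSet o n).indicator 1 ω * g (ω n) ∂(r.jumpChainLaw x) =
      ((r.tabooStep o)^[n] g) x := by
  classical
  induction n generalizing g with
  | zero =>
    have h : avoidSet o 0 = Set.univ := Set.eq_univ_of_forall fun ω k hk hk' => by omega
    simp only [h, Set.indicator_univ, Pi.one_apply, one_mul, Function.iterate_zero, id]
    rw [← lintegral_map (f := g) (g := fun ω : ℕ → E => ω 0) Measurable.of_discrete
      (by fun_prop), map_eval_zero_jumpChainLaw, lintegral_dirac]
  | succ n ih =>
    -- The last step is peeled off, so the Markov property at time `n` applies to the taboo event,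
    -- which depends only on the past.
    rw [Function.iterate_succ_apply, ← ih]
    let F : ((i : Finset.Iic n) → E) → ℝ≥0∞ :=
      {y | ∀ k : Finset.Iic n, 1 ≤ (k : ℕ) → y k ≠ o}.indicator 1
    have hF : Measurable F := Measurable.of_discrete
    have hFω : ∀ ω : ℕ → E, F (Preorder.frestrictLe n ω) = (avoidSet o n).indicator 1 ω := by
      intro ω
      have : Preorder.frestrictLe (π := fun _ : ℕ => E) n ω ∈
          {y : (i : Finset.Iic n) → E | ∀ k : Finset.Iic n, 1 ≤ (k : ℕ) → y k ≠ o} ↔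
          ω ∈ avoidSet o n :=
        ⟨fun h k h1 h2 => h ⟨k, Finset.mem_Iic.2 h2⟩ h1,
          fun h k h1 => h k h1 (Finset.mem_Iic.1 k.2)⟩
      simp only [F, Set.indicator_apply, this, Pi.one_apply]
    have key := r.lintegral_jumpChainLaw_succ x n hF (fun y => if y = o then 0 else g y)
    simp only [hFω] at key
    refine Eq.trans (lintegral_congr fun ω => ?_) key
    simp only [Set.indicator_apply, mem_avoidSet_succ, Pi.one_apply]
    split_ifs <;> simp_all

lemma jumpChainLaw_avoidSet (r : JumpRates E) (o x : E) (n : ℕ) :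
    r.jumpChainLaw x (avoidSet o n) = ((r.tabooStep o)^[n] 1) x := by
  rw [← lintegral_avoidSet, ← lintegral_indicator_one (measurableSet_avoidSet o n)]
  simp

/-- The jump chain started from `o` returns to `o` almost surely exactly when the probabilities of
avoiding `o` up to time `n` decrease to zero. -/
lemma ae_return_iff (r : JumpRates E) (o : E) :
    (∀ᵐ ω ∂(r.jumpChainLaw o), ∃ n, 1 ≤ n ∧ ω n = o) ↔
      ⨅ n, ((r.tabooStep o)^[n] 1) o = 0 := by
  rw [ae_iff]
  have h : {ω : ℕ → E | ¬ ∃ n, 1 ≤ n ∧ ω n = o} = ⋂ n, avoidSet o n := by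
    ext ω
    simp only [Set.mem_ofPred_eq, Set.mem_iInter, not_exists, not_and]
    exact ⟨fun h n k hk _ => h k hk, fun h k hk => h k k hk le_rfl⟩
  rw [h, Antitone.measure_iInter]
  · simp only [jumpChainLaw_avoidSet]
  · intro m n hmn ω hω k hk hk'
    exact hω k hk (hk'.trans hmn)
  · exact fun n => (measurableSet_avoidSet o n).nullMeasurableSet
  · exact ⟨0, measure_ne_top _ _⟩

end JumpChain

section Paths

variable {E : Type*}

/-! ### Return times and the jump chain -/

lemma monotone_jumpTime (r : JumpRates E) (ω : (ℕ → E) × (ℕ → ℝ)) : Monotone (r.jumpTime ω) :=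
  monotone_nat_of_le_succ fun n => by
    simp only [jumpTime, Finset.sum_range_succ]
    exact le_self_add

/-- Having been elsewhere before time `t` forces at least one jump by time `t`: before the first
jump the path is constant. This direction holds for every `ω`. -/
lemma exists_return_of_returnTime_lt_top (r : JumpRates E) {o : E} {ω : (ℕ → E) × (ℕ → ℝ)}
    (h : r.returnTime {o} ω < ∞) : ∃ n, 1 ≤ n ∧ ω.1 n = o := by
  classical
  have hne : {τ : ℝ≥0∞ | ∃ t : ℝ≥0, τ = t ∧ 0 < t ∧ r.X ω t ∈ some '' {o} ∧
      ∃ s : ℝ≥0, 0 < s ∧ s < t ∧ r.X ω s ≠ r.X ω 0}.Nonempty := by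
    by_contra hempty
    rw [returnTime, Set.not_nonempty_iff_eq_empty.1 hempty, sInf_empty] at h
    exact lt_irrefl _ h
  obtain ⟨_, t, rfl, -, ⟨_, rfl, hX⟩, s, -, hst, hs⟩ := hne
  have ht : ∃ n, (t : ℝ≥0∞) < r.jumpTime ω (n + 1) := by
    by_contra hn
    rw [X, dif_neg hn] at hX
    exact absurd hX (by simp)
  rw [X, dif_pos ht] at hX
  refine ⟨Nat.find ht, ?_, (Option.some.inj hX).symm⟩
  by_contra hlt
  have h0 : Nat.find ht = 0 := by omega
  have ht0 : (t : ℝ≥0∞) < r.jumpTime ω (0 + 1) := h0 ▸ Nat.find_spec ht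
  have aux : ∀ u : ℝ≥0, u ≤ t → r.X ω u = some (ω.1 0) := by
    intro u hu
    have hu0 : (u : ℝ≥0∞) < r.jumpTime ω (0 + 1) := lt_of_le_of_lt (by exact_mod_cast hu) ht0
    have hex : ∃ n, (u : ℝ≥0∞) < r.jumpTime ω (n + 1) := ⟨0, hu0⟩
    rw [X, dif_pos hex]
    rw [(Nat.find_eq_zero hex).2 hu0]
  exact hs ((aux s hst.le).trans (aux 0 zero_le).symm)

lemma X_eq_of_eq_jumpTime (r : JumpRates E) {ω : (ℕ → E) × (ℕ → ℝ)}
    (hω : StrictMono (r.jumpTime ω)) {t : ℝ≥0} {n : ℕ} (ht : (t : ℝ≥0∞) = r.jumpTime ω n) :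
    r.X ω t = some (ω.1 n) := by
  classical
  have hn : (t : ℝ≥0∞) < r.jumpTime ω (n + 1) := ht ▸ hω (Nat.lt_succ_self n)
  have hex : ∃ n, (t : ℝ≥0∞) < r.jumpTime ω (n + 1) := ⟨n, hn⟩
  rw [X, dif_pos hex]
  rw [(Nat.find_eq_iff hex).2 ⟨hn, fun m hm => ?_⟩]
  rw [ht, not_lt]
  exact r.monotone_jumpTime ω hm

/-- The `n`-th jump time is a finite sum of finite positive holding times, hence a valid return
time. The first jump, which leads away from `o`, supplies the required earlier excursion. -/
lemma returnTime_lt_top_of_exists_return (r : JumpRates E) {o : E} {ω : (ℕ → E) × (ℕ → ℝ)}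
    (hrate : ∀ x, r.holdingRate x ≠ 0) (hclock : ∀ k, 0 < ω.2 k) (h0 : ω.1 0 = o)
    (h1 : ω.1 1 ≠ o) (h : ∃ n, 1 ≤ n ∧ ω.1 n = o) : r.returnTime {o} ω < ∞ := by
  obtain ⟨n, hn, hno⟩ := h
  have hpos : ∀ k, r.holdingTime ω k ≠ 0 := fun k => by
    simp [holdingTime, ENNReal.div_eq_zero_iff, hclock k]
  have hfin : ∀ k, r.holdingTime ω k ≠ ∞ := fun k =>
    ENNReal.div_ne_top ENNReal.ofReal_ne_top (by simpa using hrate _)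
  have hJ : ∀ k, r.jumpTime ω k ≠ ∞ := fun k => ENNReal.sum_ne_top.2 fun i _ => hfin i
  have hmono : StrictMono (r.jumpTime ω) := strictMono_nat_of_lt_succ fun k => by
    have : r.jumpTime ω (k + 1) = r.jumpTime ω k + r.holdingTime ω k :=
      Finset.sum_range_succ ..
    rw [this]
    exact ENNReal.lt_add_right (hJ k) (hpos k)
  have hn1 : 1 < n := lt_of_le_of_ne hn fun h => h1 (h ▸ hno)
  have hcoe : ∀ k, (((r.jumpTime ω k).toNNReal : ℝ≥0) : ℝ≥0∞) = r.jumpTime ω k :=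
    fun k => ENNReal.coe_toNNReal (hJ k)
  have hlt : ∀ {i j}, i < j → (r.jumpTime ω i).toNNReal < (r.jumpTime ω j).toNNReal :=
    fun {i j} hij => ENNReal.coe_lt_coe.1 (by rw [hcoe, hcoe]; exact hmono hij)
  have hzero : ((0 : ℝ≥0) : ℝ≥0∞) = r.jumpTime ω 0 := by simp [jumpTime]
  refine lt_of_le_of_lt (b := ((r.jumpTime ω n).toNNReal : ℝ≥0∞)) (sInf_le ?_) ENNReal.coe_lt_top
  refine ⟨_, rfl, (zero_le).trans_lt (hlt (i := 0) (by omega)), ⟨o, rfl, ?_⟩,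
    (r.jumpTime ω 1).toNNReal, (zero_le).trans_lt (hlt (i := 0) (by omega)), hlt hn1, ?_⟩
  · rw [r.X_eq_of_eq_jumpTime hmono (hcoe n), hno]
  · rw [r.X_eq_of_eq_jumpTime hmono (hcoe 1), r.X_eq_of_eq_jumpTime hmono hzero, h0]
    exact fun h => h1 (Option.some.inj h)

lemma Irreducible.holdingRate_ne_zero {r : JumpRates E} (hirr : r.Irreducible) {o : E}
    (ho : r.holdingRate o ≠ 0) (x : E) : r.holdingRate x ≠ 0 := by
  rcases Relation.ReflTransGen.cases_head (hirr x o) with h | ⟨y, hy, -⟩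
  · exact h ▸ ho
  · exact (hy.trans_le ((r.summable_rate x).le_tsum y fun _ _ => zero_le)).ne'

end Paths

/-! ### Almost sure properties of the clocks and of the first jump -/

section ReturnTime

variable {E : Type*} [Countable E] [MeasurableSpace E] [DiscreteMeasurableSpace E]

lemma jumpKernel_apply_singleton (r : JumpRates E) {x : E} (hx : r.holdingRate x ≠ 0) (y : E) :
    r.jumpKernel x {y} = r.rate x y / r.holdingRate x := by
  have h : r.jumpKernel x {y} = r.jumpPMF x y :=
    PMF.toMeasure_apply_singleton _ _ (measurableSet_singleton y)
  rw [h, jumpPMF, dif_neg hx, PMF.normalize_apply, ← ENNReal.coe_tsum (r.summable_rate x),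
    div_eq_mul_inv]
  rfl

lemma ae_expMeasure_pos (a : ℝ) : ∀ᵐ t ∂(expMeasure a), 0 < t := by
  have h : ∀ᵐ t ∂(volume : Measure ℝ), t ≠ 0 := by simp [ae_iff]
  have hm : Measurable (gammaPDF 1 a) := (measurable_gammaPDFReal 1 a).ennreal_ofReal
  rw [expMeasure, gammaMeasure, ae_withDensity_iff hm]
  filter_upwards [h] with t ht hd
  by_contra hlt
  exact hd (gammaPDF_of_neg (lt_of_le_of_ne (not_lt.1 hlt) ht))

lemma ae_clockLaw_pos : ∀ᵐ c ∂clockLaw, ∀ k, 0 < c k := by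
  refine ae_all_iff.2 fun k => ?_
  exact (measurePreserving_eval_infinitePi (fun _ : ℕ => expMeasure 1) k).quasiMeasurePreserving.ae
    (ae_expMeasure_pos 1)

lemma ae_eval_one_ne (r : JumpRates E) {o : E} (ho : r.holdingRate o ≠ 0) :
    ∀ᵐ ω ∂(r.jumpChainLaw o), ω 1 ≠ o := by
  have h := r.lintegral_jumpChainLaw_succ o 0 (F := 1) measurable_one (({o} : Set E).indicator 1)
  have hz : ∀ᵐ ω ∂(r.jumpChainLaw o),
      ∫⁻ y, ({o} : Set E).indicator 1 y ∂(r.jumpKernel (ω 0)) = 0 := by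
    filter_upwards [r.ae_eval_zero_jumpChainLaw o] with ω hω
    rw [lintegral_indicator_one (measurableSet_singleton o), hω,
      r.jumpKernel_apply_singleton ho, r.rate_self]
    simp
  simp only [Pi.one_apply, one_mul, zero_add] at h
  rw [lintegral_congr_ae hz, lintegral_zero, lintegral_eq_zero_iff] at h
  · filter_upwards [h] with ω hω hωo
    simp [hωo] at hω
  · exact (Measurable.of_discrete (f := ({o} : Set E).indicator (1 : E → ℝ≥0∞))).comp
      (measurable_pi_apply 1)

lemma ae_return_of_ae_returnTime_lt_top (r : JumpRates E) {o : E}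
    (h : ∀ᵐ ω ∂(r.law o), r.returnTime {o} ω < ∞) :
    ∀ᵐ ω ∂(r.jumpChainLaw o), ∃ n, 1 ≤ n ∧ ω n = o := by
  have h' : ∀ᵐ ω ∂(r.law o), ∃ n, 1 ≤ n ∧ ω.1 n = o :=
    h.mono fun ω hω => r.exists_return_of_returnTime_lt_top hω
  have := Measure.ae_ae_of_ae_prod h'
  filter_upwards [this] with ω hω
  -- The event does not involve the clocks, so a single clock sequence from the probability measure
  -- `clockLaw` suffices.
  exact hω.exists.choose_spec

lemma ae_returnTime_lt_top_of_ae_return (r : JumpRates E) {o : E}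
    (hrate : ∀ x, r.holdingRate x ≠ 0)
    (h : ∀ᵐ ω ∂(r.jumpChainLaw o), ∃ n, 1 ≤ n ∧ ω n = o) :
    ∀ᵐ ω ∂(r.law o), r.returnTime {o} ω < ∞ := by
  filter_upwards [Measure.quasiMeasurePreserving_fst.ae h,
    Measure.quasiMeasurePreserving_fst.ae (r.ae_eval_zero_jumpChainLaw o),
    Measure.quasiMeasurePreserving_fst.ae (r.ae_eval_one_ne (hrate o)),
    Measure.quasiMeasurePreserving_snd.ae ae_clockLaw_pos] with ω h h0 h1 hc
  exact r.returnTime_lt_top_of_exists_return hrate hc h0 h1 h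

end ReturnTime

section Hitting

variable {E : Type*} [Countable E] [MeasurableSpace E] [DiscreteMeasurableSpace E]

/-! ### Hitting probabilities -/

open Classical in
/-- The probability that the jump chain started from `x` hits `o` within `n` steps and before
leaving `K`. -/
noncomputable def hitWithin (r : JumpRates E) (o : E) (K : Set E) : ℕ → E → ℝ≥0∞
  | 0, x => if x = o then 1 else 0
  | n + 1, x =>
    if x = o then 1 else if x ∈ K then ∫⁻ y, hitWithin r o K n y ∂(r.jumpKernel x) else 0

/-- The probability that the jump chain started from `x` hits `o` before leaving `K`. -/
noncomputable def hitProb (r : JumpRates E) (o : E) (K : Set E) (x : E) : ℝ≥0∞ :=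
  ⨆ n, r.hitWithin o K n x

/-- The probability that the jump chain started from `o` returns to `o` before leaving `K`. -/
noncomputable def returnProb (r : JumpRates E) (o : E) (K : Set E) : ℝ≥0∞ :=
  ∫⁻ y, r.hitProb o K y ∂(r.jumpKernel o)

variable (r : JumpRates E) (o : E)

lemma hitWithin_self (K : Set E) (n : ℕ) : r.hitWithin o K n o = 1 := by
  cases n <;> simp [hitWithin]

lemma hitWithin_of_notMem {K : Set E} (ho : o ∈ K) {x : E} (hx : x ∉ K) (n : ℕ) :
    r.hitWithin o K n x = 0 := by
  have : x ≠ o := fun h => hx (h ▸ ho)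
  cases n <;> simp [hitWithin, this, hx]

lemma hitWithin_le_succ (K : Set E) (n : ℕ) (x : E) :
    r.hitWithin o K n x ≤ r.hitWithin o K (n + 1) x := by
  induction n generalizing x with
  | zero => by_cases hx : x = o <;> simp [hitWithin, hx]
  | succ n ih =>
    rw [hitWithin, hitWithin]
    split_ifs
    · exact le_rfl
    · exact lintegral_mono ih
    · exact le_rfl

lemma monotone_hitWithin (K : Set E) : Monotone (r.hitWithin o K) :=
  monotone_nat_of_le_succ fun n x => r.hitWithin_le_succ o K n x

lemma hitWithin_mono {K K' : Set E} (h : K ⊆ K') (n : ℕ) (x : E) :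
    r.hitWithin o K n x ≤ r.hitWithin o K' n x := by
  induction n generalizing x with
  | zero => exact le_rfl
  | succ n ih =>
    rw [hitWithin, hitWithin]
    split_ifs with h1 h2 h3 h3
    · exact le_rfl
    · exact lintegral_mono ih
    · exact absurd (h h2) h3
    · exact zero_le
    · exact le_rfl

/-- Monotone convergence along the directed family of finite sets, one step at a time; `x` is
inserted into `K` so that the first step is allowed. -/
lemma hitWithin_univ (n : ℕ) (x : E) :
    r.hitWithin o Set.univ n x = ⨆ K : Finset E, r.hitWithin o K n x := by
  classical
  induction n generalizing x with
  | zero => simp [hitWithin]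
  | succ n ih =>
    refine le_antisymm ?_ (iSup_le fun K => r.hitWithin_mono o (Set.subset_univ _) _ x)
    by_cases hx : x = o
    · subst hx
      exact le_iSup_of_le ∅ (by simp [hitWithin_self])
    · rw [hitWithin, if_neg hx, if_pos (Set.mem_univ x), lintegral_congr ih,
        lintegral_iSup_directed]
      · refine iSup_le fun K => le_iSup_of_le (insert x K) ?_
        rw [hitWithin, if_neg hx, if_pos (by simp)]
        exact lintegral_mono fun y => r.hitWithin_mono o (by simp) n y
      · exact fun K => Measurable.of_discrete.aemeasurable
      · exact Monotone.directed_le fun K K' h y => r.hitWithin_mono o (by simpa using h) n y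

-- Hitting and avoiding `o` are complementary. The avoidance term is set to zero at `o` because the
-- taboo iterates ignore time 0, whereas `hitWithin` counts it.
open Classical in
lemma hitWithin_univ_add_taboo (n : ℕ) (x : E) :
    r.hitWithin o Set.univ n x + (if x = o then 0 else ((r.tabooStep o)^[n] 1) x) = 1 := by
  induction n generalizing x with
  | zero => by_cases hx : x = o <;> simp [hitWithin, hx]
  | succ n ih =>
    by_cases hx : x = o
    · simp [hx, hitWithin_self]
    · rw [hitWithin, if_neg hx, if_pos (Set.mem_univ x), if_neg hx,
        Function.iterate_succ_apply', tabooStep, ← lintegral_add_left Measurable.of_discrete,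
        lintegral_congr ih]
      simp

lemma lintegral_hitWithin_add_taboo (n : ℕ) (x : E) :
    ∫⁻ y, r.hitWithin o Set.univ n y ∂(r.jumpKernel x) + ((r.tabooStep o)^[n + 1] 1) x = 1 := by
  rw [Function.iterate_succ_apply', tabooStep, ← lintegral_add_left Measurable.of_discrete,
    lintegral_congr (r.hitWithin_univ_add_taboo o n)]
  simp

lemma lintegral_hitProb (K : Set E) (x : E) :
    ∫⁻ y, r.hitProb o K y ∂(r.jumpKernel x) =
      ⨆ n, ∫⁻ y, r.hitWithin o K n y ∂(r.jumpKernel x) :=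
  lintegral_iSup (fun _ => Measurable.of_discrete) (r.monotone_hitWithin o K)

lemma hitProb_mono {K K' : Set E} (h : K ⊆ K') (x : E) : r.hitProb o K x ≤ r.hitProb o K' x :=
  iSup_mono fun n => r.hitWithin_mono o h n x

lemma returnProb_mono {K K' : Set E} (h : K ⊆ K') : r.returnProb o K ≤ r.returnProb o K' :=
  lintegral_mono (r.hitProb_mono o h)

lemma returnProb_univ : r.returnProb o Set.univ = ⨆ K : Finset E, r.returnProb o K := by
  have h : ∀ x, r.hitProb o Set.univ x = ⨆ K : Finset E, r.hitProb o K x := fun x => by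
    simp only [hitProb, hitWithin_univ]
    exact iSup_comm
  rw [returnProb, lintegral_congr h, lintegral_iSup_directed]
  · rfl
  · exact fun K => Measurable.of_discrete.aemeasurable
  · exact Monotone.directed_le fun K K' h y => r.hitProb_mono o (by simpa using h) y

lemma hitProb_self (K : Set E) : r.hitProb o K o = 1 := by
  simp [hitProb, hitWithin_self]

lemma hitProb_of_notMem {K : Set E} (ho : o ∈ K) {x : E} (hx : x ∉ K) : r.hitProb o K x = 0 := by
  simp [hitProb, r.hitWithin_of_notMem o ho hx]

lemma hitProb_le_one (K : Set E) (x : E) : r.hitProb o K x ≤ 1 :=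
  (r.hitProb_mono o (Set.subset_univ K) x).trans <| iSup_le fun n => by
    rw [← r.hitWithin_univ_add_taboo o n x]
    exact le_self_add

lemma returnProb_le_one (K : Set E) : r.returnProb o K ≤ 1 :=
  (lintegral_mono (r.hitProb_le_one o K)).trans (by simp)

/-- Harmonicity away from `o`: the first-step recursion passes to the supremum by monotone
convergence, and the index shift is immaterial. -/
lemma lintegral_hitProb_eq {K : Set E} {x : E} (hx : x ∈ K) (hxo : x ≠ o) :
    ∫⁻ y, r.hitProb o K y ∂(r.jumpKernel x) = r.hitProb o K x := by
  rw [lintegral_hitProb, hitProb, ← (monotone_nat_of_le_succ fun n =>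
    r.hitWithin_le_succ o K n x).iSup_nat_add 1]
  simp [hitWithin, hx, hxo]

/-- The jump chain returns to `o` almost surely exactly when the probabilities of returning before
leaving a finite set increase to one. -/
lemma ae_return_iff_iSup_returnProb :
    (∀ᵐ ω ∂(r.jumpChainLaw o), ∃ n, 1 ≤ n ∧ ω n = o) ↔
      ⨆ K : Finset E, r.returnProb o K = 1 := by
  have hle : ∀ n, ((r.tabooStep o)^[n + 1] 1) o ≤ 1 := fun n => by
    rw [← r.lintegral_hitWithin_add_taboo o n o]
    exact le_add_self
  -- The term at time 0 equals 1, an upper bound for all later terms, so it can be dropped from the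
  -- infimum.
  have hinf : ⨅ n, ((r.tabooStep o)^[n] 1) o = ⨅ n, ((r.tabooStep o)^[n + 1] 1) o := by
    refine le_antisymm (le_iInf fun n => iInf_le _ (n + 1)) (le_iInf fun n => ?_)
    cases n with
    | zero => exact (iInf_le _ 0).trans (hle 0)
    | succ n => exact iInf_le (fun n => ((r.tabooStep o)^[n + 1] 1) o) n
  have hsub : ∀ n, ∫⁻ y, r.hitWithin o Set.univ n y ∂(r.jumpKernel o) =
      1 - ((r.tabooStep o)^[n + 1] 1) o := fun n =>
    ENNReal.eq_sub_of_add_eq ((hle n).trans_lt ENNReal.one_lt_top).ne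
      (r.lintegral_hitWithin_add_taboo o n o)
  have hone : ⨅ n, ((r.tabooStep o)^[n + 1] 1) o ≤ 1 := (iInf_le _ 0).trans (hle 0)
  rw [ae_return_iff, ← returnProb_univ, returnProb, lintegral_hitProb]
  simp only [hsub]
  rw [← ENNReal.sub_iInf, hinf]
  constructor
  · intro h
    rw [h, tsub_zero]
  · intro h
    have := tsub_add_cancel_of_le hone
    rw [h] at this
    exact (ENNReal.add_right_inj ENNReal.one_ne_top).1 (by rw [this, add_zero])

end Hitting

section Dirichlet

variable {E : Type*} {r : JumpRates E} {μ : E → ℝ≥0}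

/-! ### Stationary measures and the Dirichlet form -/

/-- Zeros of `μ` propagate backwards along positive rates: balance at a zero forces every incoming
flow to vanish. Irreducibility would then make `μ` identically zero. -/
lemma IsStationary.apply_ne_zero (hμ : r.IsStationary μ) (hirr : r.Irreducible) (x : E) :
    μ x ≠ 0 := by
  intro hx
  have step : ∀ a b, 0 < r.rate a b → μ b = 0 → μ a = 0 := by
    intro a b hab hb
    have h : HasSum (fun z => μ z * r.rate z b) 0 := by simpa [hb] using hμ.balance b
    exact (mul_eq_zero.1 (hasSum_zero_iff.1 h a)).resolve_right hab.ne'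
  refine hμ.ne_zero (funext fun y => ?_)
  induction hirr y x using Relation.ReflTransGen.head_induction_on with
  | refl => exact hx
  | head hab _ ih => exact step _ _ hab ih

lemma IsStationary.mul_symmetrized_rate (hμ : r.IsStationary μ) {x : E} (hx : μ x ≠ 0) (y : E) :
    μ x * (r.symmetrized hμ).rate x y = (μ x * r.rate x y + μ y * r.rate y x) / 2 := by
  simp only [symmetrized, adjoint]
  field_simp

/-- Stationarity says exactly that the time-reversed chain has the same holding rates, so averaging
preserves them. -/
lemma IsStationary.holdingRate_symmetrized (hμ : r.IsStationary μ) {x : E} (hx : μ x ≠ 0) :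
    (r.symmetrized hμ).holdingRate x = r.holdingRate x := by
  have h1 : HasSum (r.rate x) (r.holdingRate x) := (r.summable_rate x).hasSum
  have h2 := (h1.add ((hμ.balance x).div_const (μ x))).div_const 2
  rw [mul_div_cancel_left₀ _ hx, add_self_div_two] at h2
  exact h2.tsum_eq

lemma summable_coe_rate (r : JumpRates E) (x : E) : Summable fun y => (r.rate x y : ℝ) :=
  NNReal.summable_coe.2 (r.summable_rate x)

lemma generator_eq_sub (r : JumpRates E) {f : E → ℝ} {x : E}
    (hf : Summable fun y => (r.rate x y : ℝ) * f y) :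
    r.generator f x = ∑' y, (r.rate x y : ℝ) * f y - r.holdingRate x * f x := by
  simp only [generator, mul_sub]
  rw [hf.tsum_sub ((r.summable_coe_rate x).mul_right _), tsum_mul_right, holdingRate,
    NNReal.coe_tsum]

lemma innerMu_neg (μ : E → ℝ≥0) (f g : E → ℝ) : innerMu μ (-f) g = -innerMu μ f g := by
  simp only [innerMu, Pi.neg_apply, mul_neg, neg_mul, tsum_neg]

lemma innerMu_neg_generator_self (r : JumpRates E) (μ : E → ℝ≥0) {f : E → ℝ} {K : Finset E}
    (hf : ∀ x ∉ K, f x = 0) :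
    innerMu μ (-r.generator f) f = ∑ x ∈ K, (μ x : ℝ) * r.holdingRate x * f x ^ 2 -
      ∑ x ∈ K, ∑ y ∈ K, (μ x * r.rate x y : ℝ) * f x * f y := by
  rw [innerMu, tsum_eq_sum (s := K) fun x hx => by rw [hf x hx, mul_zero],
    ← Finset.sum_sub_distrib]
  refine Finset.sum_congr rfl fun x _ => ?_
  have h : HasSum (fun y => (r.rate x y : ℝ) * f y) (∑ y ∈ K, (r.rate x y : ℝ) * f y) :=
    hasSum_sum_of_ne_finset_zero fun y hy => by rw [hf y hy, mul_zero]
  rw [Pi.neg_apply, r.generator_eq_sub h.summable, h.tsum_eq,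
    Finset.sum_congr rfl fun y _ => show (μ x * r.rate x y : ℝ) * f x * f y =
      μ x * f x * (r.rate x y * f y) by ring, ← Finset.mul_sum]
  ring

/-- The chain and its reversible version have the same Dirichlet form. -/
lemma IsStationary.innerMu_symmetrized (hμ : r.IsStationary μ) (hpos : ∀ x, μ x ≠ 0)
    {f : E → ℝ} {K : Finset E} (hf : ∀ x ∉ K, f x = 0) :
    innerMu μ (-(r.symmetrized hμ).generator f) f = innerMu μ (-r.generator f) f := by
  rw [innerMu_neg_generator_self _ _ hf, innerMu_neg_generator_self _ _ hf]
  congr 1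
  · exact Finset.sum_congr rfl fun x _ => by rw [hμ.holdingRate_symmetrized (hpos x)]
  · have h : ∀ x y, (μ x * (r.symmetrized hμ).rate x y : ℝ) * f x * f y =
        ((μ x * r.rate x y : ℝ) * f x * f y + (μ y * r.rate y x : ℝ) * f y * f x) / 2 := by
      intro x y
      have := congrArg (fun t : ℝ≥0 => (t : ℝ)) (hμ.mul_symmetrized_rate (hpos x) y)
      push_cast at this
      rw [this]
      ring
    simp only [h, ← Finset.sum_div, Finset.sum_add_distrib]
    -- Exchanging the finite sums identifies the two halves: the antisymmetric part of `L` drops out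
    -- of the quadratic form.
    rw [Finset.sum_comm (f := fun x y => (μ y * r.rate y x : ℝ) * f y * f x)]
    ring

end Dirichlet

section Equilibrium

variable {E : Type*} [Countable E] [MeasurableSpace E] [DiscreteMeasurableSpace E]

/-! ### Equilibrium potentials -/

lemma generator_toReal (r : JumpRates E) {x : E} (hx : r.holdingRate x ≠ 0) {g : E → ℝ≥0∞}
    (hg : ∀ y, g y ≤ 1) :
    r.generator (fun y => (g y).toReal) x =
      r.holdingRate x * ((∫⁻ y, g y ∂(r.jumpKernel x)).toReal - (g x).toReal) := by
  have hs : Summable fun y => (r.rate x y : ℝ) * (g y).toReal :=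
    Summable.of_nonneg_of_le (fun y => by positivity)
      (fun y => mul_le_of_le_one_right (NNReal.coe_nonneg _)
        (ENNReal.toReal_mono ENNReal.one_ne_top (hg y))) (r.summable_coe_rate x)
  rw [r.generator_eq_sub hs, lintegral_countable', ENNReal.tsum_toReal_eq, mul_sub, ← tsum_mul_left]
  · congr 2
    ext y
    have : (r.holdingRate x : ℝ) ≠ 0 := by exact_mod_cast hx
    rw [r.jumpKernel_apply_singleton hx, ENNReal.toReal_mul, ENNReal.toReal_div]
    simp only [ENNReal.coe_toReal]
    field_simp
  · exact fun y => ENNReal.mul_ne_top ((hg y).trans_lt ENNReal.one_lt_top).ne (measure_ne_top _ _)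

/-- The equilibrium potential of `o` in `K`: the probability of hitting `o` before leaving `K`. -/
noncomputable def potential (r : JumpRates E) (o : E) (K : Set E) (x : E) : ℝ :=
  (r.hitProb o K x).toReal

variable (r : JumpRates E) {o : E}

lemma potential_self (K : Set E) : r.potential o K o = 1 := by
  simp [potential, hitProb_self]

lemma potential_of_notMem {K : Set E} (ho : o ∈ K) {x : E} (hx : x ∉ K) :
    r.potential o K x = 0 := by
  simp [potential, r.hitProb_of_notMem o ho hx]

/-- Only the term at `o` survives: the potential is harmonic on the rest of `K`, and `g` vanishes
outside. The freedom in `g` allows pairing with the potential of another chain. -/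
lemma innerMu_generator_potential (hrate : ∀ x, r.holdingRate x ≠ 0) (μ : E → ℝ≥0) {K : Set E}
    {g : E → ℝ} (hg : ∀ x ∉ K, g x = 0) (hgo : g o = 1) :
    innerMu μ (r.generator (r.potential o K)) g =
      -(μ o * r.holdingRate o * (1 - (r.returnProb o K).toReal)) := by
  have hgen : ∀ x, r.generator (r.potential o K) x = r.holdingRate x *
      ((∫⁻ y, r.hitProb o K y ∂(r.jumpKernel x)).toReal - (r.hitProb o K x).toReal) :=
    fun x => r.generator_toReal (hrate x) (r.hitProb_le_one o K)
  rw [innerMu, tsum_eq_single o]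
  · rw [hgen, hgo, ← returnProb, hitProb_self, ENNReal.toReal_one]
    ring
  · intro x hx
    by_cases hxK : x ∈ K
    · rw [hgen, r.lintegral_hitProb_eq o hxK hx]
      ring
    · rw [hg x hxK, mul_zero]

/-- Under the sector condition the escape probabilities from finite sets are controlled by those
of the reversible version of the chain. -/
lemma SectorCondition.escape_le {r : JumpRates E} (hirr : r.Irreducible) {μ : E → ℝ≥0}
    (hμ : r.IsStationary μ) {C₀ : ℝ} (hC : r.SectorCondition μ C₀) (ho : r.holdingRate o ≠ 0)
    {K : Finset E} (hoK : o ∈ K) :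
    (1 - (r.returnProb o K).toReal) ^ 2 ≤ C₀ * (1 - (r.returnProb o K).toReal) *
      (1 - ((r.symmetrized hμ).returnProb o K).toReal) := by
  have hpos := hμ.apply_ne_zero hirr
  have hrate := hirr.holdingRate_ne_zero ho
  have hrateS : ∀ x, (r.symmetrized hμ).holdingRate x ≠ 0 := fun x => by
    rw [hμ.holdingRate_symmetrized (hpos x)]
    exact hrate x
  have hoK' : o ∈ (K : Set E) := hoK
  have hf : ∀ x ∉ (K : Set E), r.potential o K x = 0 := fun x => r.potential_of_notMem hoK'
  have hg : ∀ x ∉ (K : Set E), (r.symmetrized hμ).potential o K x = 0 :=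
    fun x => (r.symmetrized hμ).potential_of_notMem hoK'
  have fin : ∀ {h : E → ℝ}, (∀ x ∉ (K : Set E), h x = 0) → h.support.Finite := fun {h} hh =>
    K.finite_toSet.subset fun x hx => by_contra fun hxK => hx (hh x hxK)
  have key := hC _ _ (fin hf) (fin hg)
  -- The potential `g` is harmonic for `S` and not for `L`, so the last factor must first be
  -- rewritten as the form of `S`.
  rw [← hμ.innerMu_symmetrized hpos (K := K) (f := (r.symmetrized hμ).potential o K)
    (by simpa using hg), innerMu_neg, innerMu_neg,
    r.innerMu_generator_potential hrate μ hg (potential_self _ _),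
    r.innerMu_generator_potential hrate μ hf (potential_self _ _),
    (r.symmetrized hμ).innerMu_generator_potential hrateS μ hg (potential_self _ _),
    hμ.holdingRate_symmetrized (hpos o)] at key
  have hm : (0 : ℝ) < μ o * r.holdingRate o := by
    have h1 : (0 : ℝ) < μ o := NNReal.coe_pos.2 (pos_iff_ne_zero.2 (hpos o))
    have h2 : (0 : ℝ) < r.holdingRate o := NNReal.coe_pos.2 (pos_iff_ne_zero.2 ho)
    positivity
  -- Both sides of `key` carry the factor `(μ(o) λ(o))²`.
  refine le_of_mul_le_mul_left ?_ (pow_pos hm 2)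
  linarith

/-- The sector condition carries recurrence of the jump chain over from the reversible version. -/
lemma SectorCondition.iSup_returnProb_eq_one {r : JumpRates E} (hirr : r.Irreducible)
    {μ : E → ℝ≥0} (hμ : r.IsStationary μ) {C₀ : ℝ} (hC : r.SectorCondition μ C₀)
    (ho : r.holdingRate o ≠ 0)
    (hS : ⨆ K : Finset E, (r.symmetrized hμ).returnProb o K = 1) :
    ⨆ K : Finset E, r.returnProb o K = 1 := by
  have lim : ∀ q : JumpRates E, Filter.Tendsto (fun K : Finset E => (q.returnProb o K).toReal)
      Filter.atTop (nhds (⨆ K : Finset E, q.returnProb o K).toReal) := fun q => by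
    have hle : ⨆ K : Finset E, q.returnProb o K ≤ 1 := iSup_le fun K => q.returnProb_le_one o K
    exact (ENNReal.tendsto_toReal (hle.trans_lt ENNReal.one_lt_top).ne).comp
      (tendsto_atTop_iSup fun K K' h => q.returnProb_mono o (by simpa using h))
  have hle : ⨆ K : Finset E, r.returnProb o K ≤ 1 := iSup_le fun K => r.returnProb_le_one o K
  have h1 := lim r
  have h2 := lim (r.symmetrized hμ)
  rw [hS, ENNReal.toReal_one] at h2
  have hev : ∀ᶠ K : Finset E in Filter.atTop, (1 - (r.returnProb o K).toReal) ^ 2 ≤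
      C₀ * (1 - (r.returnProb o K).toReal) *
        (1 - ((r.symmetrized hμ).returnProb o K).toReal) := by
    filter_upwards [Filter.eventually_ge_atTop {o}] with K hK
    exact hC.escape_le hirr hμ ho (hK (Finset.mem_singleton_self o))
  -- Passing to the limit before any cancellation avoids dividing by the escape probability, which
  -- may be zero, and needs no sign for `C₀`.
  have hlim := le_of_tendsto_of_tendsto ((h1.const_sub 1).pow 2)
    (((h1.const_sub 1).const_mul C₀).mul (h2.const_sub 1)) hev
  rw [sub_self, mul_zero] at hlim
  have hone : (⨆ K : Finset E, r.returnProb o K).toReal = 1 := by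
    nlinarith [pow_eq_zero_iff (two_ne_zero) |>.1 (le_antisymm hlim (sq_nonneg _))]
  rwa [ENNReal.toReal_eq_one_iff] at hone

end Equilibrium

end JumpRates

theorem lemma4p2 {E : Type*} [Countable E] [MeasurableSpace E] [DiscreteMeasurableSpace E]
    (r : JumpRates E) (hirr : r.Irreducible) (μ : E → ℝ≥0) (hμ : r.IsStationary μ)
    (hsector : ∃ C₀ : ℝ, r.SectorCondition μ C₀)
    (hrec : (r.symmetrized hμ).Recurrent) :
    r.Recurrent := by
  intro o
  by_cases ho : r.holdingRate o = 0
  · exact Or.inl ho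
  obtain ⟨C₀, hC⟩ := hsector
  have hoS : (r.symmetrized hμ).holdingRate o ≠ 0 := by
    rwa [hμ.holdingRate_symmetrized (hμ.apply_ne_zero hirr o)]
  refine Or.inr (r.ae_returnTime_lt_top_of_ae_return (hirr.holdingRate_ne_zero ho) ?_)
  refine (r.ae_return_iff_iSup_returnProb o).2 (hC.iSup_returnProb_eq_one hirr hμ ho ?_)
  exact ((r.symmetrized hμ).ae_return_iff_iSup_returnProb o).1
    ((r.symmetrized hμ).ae_return_of_ae_returnTime_lt_top ((hrec o).resolve_left hoS))
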